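/- Let $p$ be a prime. Let $G=G_{(1,0)}^{(p)}$ be the group generated by $a_1,a_2,b_1,b_2$ subject to the requirement that $G$ has nilpotency class at most $2$ and to the relations $$a_1^p=[a_1,b_1],\quad a_2^p=[a_1,b_1],\quad b_1^p=[a_2,b_1b_2],\quad b_2^p=[a_2,b_2],\quad [a_1,a_2]=[b_1,b_2]=1,$$ and write $g_1,g_2,g_3,g_4$ for $a_1,a_2,b_1,b_2$. Let $S_p$ be the semigroup $\mathbb F_p^4$ with $x\odot y=(x_1-x_2)\,y$ (it has no identity), and let $S_p^1$ be the monoid obtained from $S_p$ by adjoining an identity. $S_p^1$ acts on the additive monoid $\mathrm{Mat}_{4,4}(\mathbb F_p)$ from the left via $\phi$, where every non-identity element acts as the zero endomorphism, and from the right via $\psi$, where $(a_{i,j})\cdot x=(x_j(a_{i,1}-a_{i,2}))_{i,j}$ for $x\in S_p$. These two actions commute, and $\mathrm{Mat}_{4,4}(\mathbb F_p)\,{}_\phi\!\bowtie_\psi S_p^1$ denotes the monoid with underlying set $\mathrm{Mat}_{4,4}(\mathbb F_p)\times S_p^1$, identity $(0,1)$ and multiplication $(A,s)(B,t)=(A\cdot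 t+s\cdot B,\;st)$. Call an endomorphism $\nu$ of $G$ normalized if each $\nu(g_j)$ lies in the set $\mathcal R=\{(a_1a_2^{-1})^{k_1}a_2^{k_2}b_1^{k_3}b_2^{k_4}\mid 0\le k_i<p\}$ (a set of representatives of the cosets of the center $\zeta G$ that contains the four generators and all powers of $a_1a_2^{-1}$). Then: 1. For every endomorphism $\varphi$ of $G$ there is exactly one pair consisting of a normalized endomorphism $\mathrm{norm}(\varphi)$ and an endomorphism $\mathrm{cent}(\varphi)$ with image in $\zeta G$ such that $\varphi(x)=\mathrm{norm}(\varphi)(x)\,\mathrm{cent}(\varphi)(x)$ for all $x\in G$. 2. Every normalized endomorphism $\nu\neq\mathrm{id}$ satisfies $\nu(g_j)=(a_1a_2^{-1})^{x_j}$ $(1\le j\le 4)$ for a unique vector $\mathrm{vec}(\nu)=(x_1,x_2,x_3,x_4)\in S_p$; for $\nu=\mathrm{id}$ let $\mathrm{vec}(\nu)$ be the identity of $S_p^1$. 3. For every endomorphism $f$ of $G$ with image in $\zeta G$ there is exactly one matrix $\mathrm{mat}(f)=(m_{i,j})\in\mathrm{Mat}_{4,4}(\mathbb F_p)$ such that $f(g_j)=[a_1,b_1]^{m_{1,j}}[a_1,b_2]^{m_{2,j}}[a_2,b_1]^{m_{3,j}}[a_2,b_2]^{m_{4,j}}$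 for $1\le j\le 4$. 4. The map $\varphi\mapsto(\mathrm{mat}(\mathrm{cent}(\varphi)),\mathrm{vec}(\mathrm{norm}(\varphi)))$ is an isomorphism of monoids from $\mathrm{End}(G)$ (under composition, $(\varphi_1\varphi_2)(x)=\varphi_1(\varphi_2(x))$) onto $\mathrm{Mat}_{4,4}(\mathbb F_p)\,{}_\phi\!\bowtie_\psi S_p^1$. -/

import Mathlib

namespace JK

open scoped commutatorElement

/-! ### Two-sided semidirect products of monoids -/

/-- The underlying set `M₁ × M₂` of the two-sided semidirect product of the additive monoid `M₁`
and the multiplicative monoid `M₂`, for a left action `φ` and a right action `ψ` (a homomorphism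
into the opposite of the endomorphism monoid) that commute with each other. -/
@[ext]
structure TwoSided {M₁ M₂ : Type*} [AddMonoid M₁] [Monoid M₂]
    (φ : M₂ →* AddMonoid.End M₁) (ψ : M₂ →* (AddMonoid.End M₁)ᵐᵒᵖ)
    (comm : ∀ (m : M₁) (s t : M₂), (ψ t).unop (φ s m) = φ s ((ψ t).unop m)) where
  left : M₁
  right : M₂

namespace TwoSided

variable {M₁ M₂ : Type*} [AddMonoid M₁] [Monoid M₂]
  {φ : M₂ →* AddMonoid.End M₁} {ψ : M₂ →* (AddMonoid.End M₁)ᵐᵒᵖ}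
  {comm : ∀ (m : M₁) (s t : M₂), (ψ t).unop (φ s m) = φ s ((ψ t).unop m)}

/-- `(m₁, m₂) ⊙ (m₁', m₂') = (m₁ m₂' + m₂ m₁', m₂ m₂')`, with identity `(0, 1)`. -/
instance : Monoid (TwoSided φ ψ comm) where
  mul x y := ⟨(ψ y.right).unop x.left + φ x.right y.left, x.right * y.right⟩
  one := ⟨0, 1⟩
  mul_assoc x y z := by
    apply TwoSided.ext
    · change (ψ z.right).unop ((ψ y.right).unop x.left + φ x.right y.left)
          + φ (x.right * y.right) z.left
        = (ψ (y.right * z.right)).unop x.left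
          + φ x.right ((ψ z.right).unop y.left + φ y.right z.left)
      simp [comm, add_assoc]
    · exact mul_assoc _ _ _
  one_mul x := by
    apply TwoSided.ext
    · change (ψ x.right).unop 0 + φ 1 x.left = x.left
      simp
    · exact one_mul _
  mul_one x := by
    apply TwoSided.ext
    · change (ψ 1).unop x.left + φ x.right 0 = x.left
      simp
    · exact mul_one _

end TwoSided

/-! ### The semigroup `S_p` and its two actions on matrices -/

/-- The underlying set `𝔽_p⁴` of the semigroup `S_p`. -/
def S (p : ℕ) : Type := Fin 4 → ZMod p

/-- `x ⊙ y = (x₁ - x₂) y`. -/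
instance (p : ℕ) : Semigroup (S p) where
  mul x y := fun j => (x 0 - x 1) * y j
  mul_assoc x y z := by
    funext j
    change ((x 0 - x 1) * y 0 - (x 0 - x 1) * y 1) * z j = (x 0 - x 1) * ((y 0 - y 1) * z j)
    ring

theorem S.mul_apply {p : ℕ} (x y : S p) (j : Fin 4) : (x * y) j = (x 0 - x 1) * y j := rfl

/-- `S_p` has no identity, so the monoid `S_p¹` is `WithOne (S p)`. -/
theorem S.not_exists_identity (p : ℕ) [Fact p.Prime] :
    ¬ ∃ e : S p, ∀ x : S p, e * x = x ∧ x * e = x := by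
  rintro ⟨e, he⟩
  let x : S p := fun _ => (1 : ZMod p)
  have h : (1 - 1 : ZMod p) * e 0 = 1 := congrFun (he x).2 0
  simp at h

/-- The monoid `S_p¹`, obtained from `S_p` by adjoining an identity. -/
abbrev S1 (p : ℕ) : Type := WithOne (S p)

/-- The left action of `S_p¹` on `Mat_{4,4}(𝔽_p)`: every non-identity element acts as zero. -/
def leftAct (p : ℕ) : S1 p →* AddMonoid.End (Matrix (Fin 4) (Fin 4) (ZMod p)) :=
  WithOne.lift
    { toFun := fun _ => 0
      map_mul' := fun _ _ => (mul_zero _).symm }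

/-- The additive endomorphism `(a_{i,j}) ↦ (x_j (a_{i,1} - a_{i,2}))` of `Mat_{4,4}(𝔽_p)`. -/
def rightEnd (p : ℕ) (x : S p) : AddMonoid.End (Matrix (Fin 4) (Fin 4) (ZMod p)) where
  toFun A := Matrix.of fun i j => x j * (A i 0 - A i 1)
  map_zero' := by
    ext i j
    simp
  map_add' A B := by
    ext i j
    simp
    ring

/-- The right action of `S_p¹` on `Mat_{4,4}(𝔽_p)`, given on `S_p` by `rightEnd`. -/
def rightAct (p : ℕ) : S1 p →* (AddMonoid.End (Matrix (Fin 4) (Fin 4) (ZMod p)))ᵐᵒᵖ :=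
  WithOne.lift
    { toFun := fun x => MulOpposite.op (rightEnd p x)
      map_mul' := fun x y => by
        rw [← MulOpposite.op_mul]
        congr 1
        refine AddMonoidHom.ext fun A => ?_
        ext i j
        change (x 0 - x 1) * y j * (A i 0 - A i 1)
          = y j * (x 0 * (A i 0 - A i 1) - x 1 * (A i 0 - A i 1))
        ring }

theorem actions_commute (p : ℕ) (A : Matrix (Fin 4) (Fin 4) (ZMod p)) (s t : S1 p) :
    (rightAct p t).unop (leftAct p s A) = leftAct p s ((rightAct p t).unop A) := by
  induction s using WithOne.recOneCoe with
  | one => simp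
  | coe x =>
    change (rightAct p t).unop 0 = 0
    exact map_zero _

/-- The monoid `Mat_{4,4}(𝔽_p) ⋈ S_p¹`. -/
abbrev MatS1 (p : ℕ) : Type := TwoSided (leftAct p) (rightAct p) (actions_commute p)

/-! ### The groups of Jonah and Konvisser -/

/-- The letters of the free group on four letters; `letter 0, letter 1, letter 2, letter 3` stand for
`a₁, a₂, b₁, b₂`. -/
def letter (j : Fin 4) : FreeGroup (Fin 4) := FreeGroup.of j

/-- Relators of the JK-group. The first set says that the nilpotency class is at most `2`. -/
def relators (p l₁ l₂ : ℕ) : Set (FreeGroup (Fin 4)) :=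
  {r | ∃ u v t : FreeGroup (Fin 4), r = ⁅⁅u, v⁆, t⁆} ∪
  { letter 0 ^ p * ⁅letter 0, letter 2⁆⁻¹,
    letter 1 ^ p * ⁅letter 0, letter 2 ^ l₁ * letter 3 ^ l₂⁆⁻¹,
    letter 2 ^ p * ⁅letter 1, letter 2 * letter 3⁆⁻¹,
    letter 3 ^ p * ⁅letter 1, letter 3⁆⁻¹,
    ⁅letter 0, letter 1⁆,
    ⁅letter 2, letter 3⁆ }

/-- The JK-group `G_λ^{(p)}` for `λ = (l₁, l₂)`. -/
abbrev Grp (p l₁ l₂ : ℕ) : Type := PresentedGroup (relators p l₁ l₂)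

/-- The exceptional JK-group `G_{(1,0)}^{(p)}`. -/
abbrev G (p : ℕ) : Type := Grp p 1 0

/-- The generators `a₁, a₂, b₁, b₂`, in this order. -/
def gen (p : ℕ) (j : Fin 4) : G p := PresentedGroup.of j

/-- The element `a₁ a₂⁻¹`. -/
def w (p : ℕ) : G p := gen p 0 * (gen p 1)⁻¹

/-- The basis `[a₁,b₁], [a₁,b₂], [a₂,b₁], [a₂,b₂]` of the center, in this order. -/
def centerBasis (p : ℕ) : Fin 4 → G p :=
  ![⁅gen p 0, gen p 2⁆, ⁅gen p 0, gen p 3⁆, ⁅gen p 1, gen p 2⁆, ⁅gen p 1, gen p 3⁆]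

/-- A set of representatives of the cosets of the center that contains the four generators and
all powers of `a₁ a₂⁻¹`. -/
def reps (p : ℕ) : Set (G p) :=
  {x | ∃ k : Fin 4 → ℕ, (∀ i, k i < p) ∧
    x = w p ^ k 0 * gen p 1 ^ k 1 * gen p 2 ^ k 2 * gen p 3 ^ k 3}

/-- Normalized endomorphisms: each generator goes to a chosen representative. -/
def IsNormalized {p : ℕ} (f : Monoid.End (G p)) : Prop := ∀ j, f (gen p j) ∈ reps p

/-- Endomorphisms mapping into the center. -/
def IsCentral {p : ℕ} (f : Monoid.End (G p)) : Prop := ∀ x, f x ∈ Subgroup.center (G p)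

/-- `n = norm(f)` and `c = cent(f)`: the endomorphism `f` is the sum (pointwise product) of the
normalized endomorphism `n` and the endomorphism `c` mapping into the center. -/
def IsNormCent {p : ℕ} (f n c : Monoid.End (G p)) : Prop :=
  IsNormalized n ∧ IsCentral c ∧ ∀ x, f x = n x * c x

/-- `v = vec(n)`: the identity of `S_p¹` if `n = id`, and otherwise the vector of the exponents of
the images of the generators, written as powers of `a₁ a₂⁻¹`. -/
def IsVec {p : ℕ} (n : Monoid.End (G p)) (v : S1 p) : Prop :=
  (n = 1 ∧ v = 1) ∨
  (n ≠ 1 ∧ ∃ x : S p, v = (x : S1 p) ∧ ∀ j, n (gen p j) = w p ^ (x j).val)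

/-- `A = mat(c)`: the `j`-th column of `A` is the coordinate vector of the image of the `j`-th
generator with respect to the basis `centerBasis p` of the center. -/
def IsMat {p : ℕ} (c : Monoid.End (G p)) (A : Matrix (Fin 4) (Fin 4) (ZMod p)) : Prop :=
  ∀ j, c (gen p j) =
    centerBasis p 0 ^ (A 0 j).val * centerBasis p 1 ^ (A 1 j).val *
    centerBasis p 2 ^ (A 2 j).val * centerBasis p 3 ^ (A 3 j).val

end JK

namespace JK

open scoped commutatorElement

/-! ### A model of the group -/

/-! Modulo its center the group is `𝔽_p⁴`, with coordinates `vb`, and the center is again `𝔽_p⁴`,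
through `cz`. Commutators and `p`-th powers depend only on `vb`, through the bilinear `pairing` and
the map `powMap` (`commutator_eq_cz`, `pow_prime_eq_cz`). These formulas are computed in the
explicit class-two group `Cover p`, which `ofCover` maps onto the JK-group. That the center does not
collapse (`cz_injective`) is seen in the quotient of `Cover p` by `relSubgroup p`: the relations
hold there, and `relSubgroup p` meets the central factor `𝔽_p⁴` trivially.

The images of the generators under an endomorphism satisfy the defining relations. By `cz_injective`
these become equations over `𝔽_p` in the sixteen coordinates modulo the center, and `classify`
solves them: the images are either the four unit vectors or four multiples of `wVec`, the
coordinates of `w = a₁a₂⁻¹`. Conversely `w ^ p = 1`, so each vector `x` gives an endomorphism `wEnd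
p x`; with the identity these are all the normalized ones. A central endomorphism factors through
`vb` and is a matrix. Hence each endomorphism is `ofPair p m` for exactly one `m`.

Composition gives the two actions. A map `wEnd p x` kills the center, so the left action of `x` is
zero. The map `centEnd p A` after `wEnd p x` has the rank-one matrix `(A · wVec) xᵀ`, and `A · wVec`
is the difference of the first two columns of `A`. -/

/-- The bilinear form describing the multiplication of the covering group `Cover p`. -/
def form {p : ℕ} (x y : Fin 4 → ZMod p) : Fin 4 → ZMod p :=
  ![y 0 * x 2, y 0 * x 3, y 1 * x 2, y 1 * x 3]

/-- The commutator pairing in the coordinates given by the four generators and `centerBasis`. -/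
def pairing {p : ℕ} (x y : Fin 4 → ZMod p) : Fin 4 → ZMod p := form y x - form x y

/-- The linear part of the `p`-th power map in coordinates. -/
def powLin {p : ℕ} (x : Fin 4 → ZMod p) : Fin 4 → ZMod p :=
  ![x 0 + x 1, 0, x 2, x 2 + x 3]

theorem form_add_left {p : ℕ} (x y z : Fin 4 → ZMod p) :
    form (x + y) z = form x z + form y z := by
  ext i; fin_cases i <;> simp [form] <;> ring

theorem form_add_right {p : ℕ} (x y z : Fin 4 → ZMod p) :
    form x (y + z) = form x y + form x z := by
  ext i; fin_cases i <;> simp [form] <;> ring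

theorem form_neg_left {p : ℕ} (x y : Fin 4 → ZMod p) : form (-x) y = -form x y := by
  ext i; fin_cases i <;> simp [form]

@[simp] theorem form_zero_left {p : ℕ} (x : Fin 4 → ZMod p) : form 0 x = 0 := by
  ext i; fin_cases i <;> simp [form]

@[simp] theorem form_zero_right {p : ℕ} (x : Fin 4 → ZMod p) : form x 0 = 0 := by
  ext i; fin_cases i <;> simp [form]

/-- Reduction modulo `p` of integral vectors. -/
def red (p : ℕ) : (Fin 4 → ℤ) →+ (Fin 4 → ZMod p) where
  toFun v i := v i
  map_zero' := by ext; simp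
  map_add' _ _ := by ext; simp

@[simp] theorem red_apply (p : ℕ) (v : Fin 4 → ℤ) (i : Fin 4) : red p v i = v i := rfl

/-- The class-two group on `ℤ⁴ × 𝔽_p⁴` of which the JK-group is a quotient. -/
@[ext]
structure Cover (p : ℕ) where
  vec : Fin 4 → ℤ
  cen : Fin 4 → ZMod p

namespace Cover

variable {p : ℕ}

instance : Mul (Cover p) :=
  ⟨fun x y => ⟨x.vec + y.vec, x.cen + y.cen - form (red p x.vec) (red p y.vec)⟩⟩

instance : One (Cover p) := ⟨⟨0, 0⟩⟩

instance : Inv (Cover p) :=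
  ⟨fun x => ⟨-x.vec, -x.cen - form (red p x.vec) (red p x.vec)⟩⟩

@[simp] theorem mul_vec (x y : Cover p) : (x * y).vec = x.vec + y.vec := rfl
@[simp] theorem mul_cen (x y : Cover p) :
    (x * y).cen = x.cen + y.cen - form (red p x.vec) (red p y.vec) := rfl
@[simp] theorem one_vec : (1 : Cover p).vec = 0 := rfl
@[simp] theorem one_cen : (1 : Cover p).cen = 0 := rfl
@[simp] theorem inv_vec (x : Cover p) : x⁻¹.vec = -x.vec := rfl
@[simp] theorem inv_cen (x : Cover p) :
    x⁻¹.cen = -x.cen - form (red p x.vec) (red p x.vec) := rfl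

instance : Group (Cover p) :=
  Group.ofLeftAxioms
    (fun x y z => by
      apply Cover.ext
      · simp [add_assoc]
      · simp only [mul_cen, mul_vec, map_add, form_add_left, form_add_right]
        abel)
    (fun x => by apply Cover.ext <;> simp)
    (fun x => by
      apply Cover.ext
      · simp
      · simp only [mul_cen, inv_cen, inv_vec, map_neg, form_neg_left, one_cen]
        abel)

theorem pow_eq (x : Cover p) (n : ℕ) :
    x ^ n = ⟨n • x.vec, n • x.cen - n.choose 2 • form (red p x.vec) (red p x.vec)⟩ := by
  induction n with
  | zero => simp; rfl
  | succ n ih =>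
    rw [pow_succ, ih]
    apply Cover.ext
    · simp [add_smul]
    · have h : form (red p (n • x.vec)) (red p x.vec) =
          n • form (red p x.vec) (red p x.vec) := by
        ext i; fin_cases i <;> simp [form] <;> ring
      simp only [mul_cen, h, Nat.choose_succ_succ n 1, Nat.choose_one_right, add_smul, one_smul]
      abel

theorem commutator_eq (x y : Cover p) : ⁅x, y⁆ = ⟨0, pairing (red p x.vec) (red p y.vec)⟩ := by
  rw [commutatorElement_def, mul_inv_eq_iff_eq_mul, mul_inv_eq_iff_eq_mul]
  apply Cover.ext
  · simp [add_comm]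
  · simp only [mul_cen, mul_vec, pairing, map_zero, form_zero_left, zero_add]
    abel

/-- The relations of the JK-group among the elements of `Cover p`. -/
def relSubgroup (p : ℕ) : Subgroup (Cover p) where
  carrier := {x | ∃ u, x.vec = p • u ∧ x.cen = -powLin (red p u)}
  one_mem' := ⟨0, by simp, by ext i; fin_cases i <;> simp [powLin]⟩
  mul_mem' := by
    rintro x y ⟨u, hu, hu'⟩ ⟨v, hv, hv'⟩
    refine ⟨u + v, by simp [hu, hv], ?_⟩
    -- The form contributes nothing, because `p • u` vanishes modulo `p`.
    rw [mul_cen, hu, hu', hv']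
    ext i; fin_cases i <;> simp [powLin, form] <;> ring
  inv_mem' := by
    rintro x ⟨u, hu, hu'⟩
    refine ⟨-u, by simp [hu], ?_⟩
    rw [inv_cen, hu, hu']
    ext i; fin_cases i <;> simp [powLin, form] <;> ring

instance : (relSubgroup p).Normal where
  conj_mem := by
    rintro x ⟨u, hu, hu'⟩ y
    refine ⟨u, by simp [hu], ?_⟩
    simp only [mul_cen, mul_vec, inv_cen, inv_vec, hu, hu']
    ext i; fin_cases i <;> simp [powLin, form] <;> ring

/-- The vector part `p • u` determines `u` because `ℤ` has no torsion. This is why the relations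
impose nothing on the central coordinates. -/
theorem mk_zero_mem_relSubgroup [NeZero p] {z : Fin 4 → ZMod p} :
    (⟨0, z⟩ : Cover p) ∈ relSubgroup p ↔ z = 0 := by
  constructor
  · rintro ⟨u, hu, hz⟩
    have hu0 : u = 0 := by
      have := (smul_eq_zero.1 hu.symm).resolve_left (NeZero.ne p)
      exact this
    subst hu0
    rw [show z = -powLin (red p 0) from hz]
    ext i; fin_cases i <;> simp [powLin]
  · rintro rfl
    exact one_mem _

/-- The `j`-th generator of `Cover p`. -/
def gen (p : ℕ) (j : Fin 4) : Cover p := ⟨Pi.single j 1, 0⟩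

end Cover

theorem commutator_commutator_model {p : ℕ} (u v t : Cover p ⧸ Cover.relSubgroup p) :
    ⁅⁅u, v⁆, t⁆ = 1 := by
  induction u using QuotientGroup.induction_on with | _ u
  induction v using QuotientGroup.induction_on with | _ v
  induction t using QuotientGroup.induction_on with | _ t
  have : ⁅⁅u, v⁆, t⁆ = 1 := by
    simp [Cover.commutator_eq, pairing]; rfl
  have h := congrArg (QuotientGroup.mk' (Cover.relSubgroup p)) this
  simp only [map_commutatorElement, map_one] at h
  exact h

/-- The homomorphism from the JK-group to its model. -/
def toModel (p : ℕ) : G p →* Cover p ⧸ Cover.relSubgroup p :=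
  PresentedGroup.toGroup (f := fun j => (Cover.gen p j : Cover p ⧸ Cover.relSubgroup p)) <| by
    rintro r (⟨u, v, t, rfl⟩ | hr)
    · simp only [map_commutatorElement]
      exact commutator_commutator_model _ _ _
    · have key : ∀ c : Cover p, c ∈ Cover.relSubgroup p →
          QuotientGroup.mk' (Cover.relSubgroup p) c = 1 := fun c hc =>
        (QuotientGroup.eq_one_iff c).2 hc
      -- The remaining relators are evaluated in `Cover p` itself, where powers and commutators have
      -- closed formulas.
      have hl : ∀ r : FreeGroup (Fin 4),
          FreeGroup.lift (fun j => (Cover.gen p j : Cover p ⧸ Cover.relSubgroup p)) r =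
          QuotientGroup.mk' (Cover.relSubgroup p) (FreeGroup.lift (Cover.gen p) r) := by
        intro r
        rw [← MonoidHom.comp_apply]
        congr 1
        ext j
        simp
      rw [hl]
      apply key
      simp only [Set.mem_insert_iff, Set.mem_singleton_iff] at hr
      rcases hr with rfl | rfl | rfl | rfl | rfl | rfl <;>
        simp only [letter, map_mul, map_inv, map_pow, map_commutatorElement,
          FreeGroup.lift_apply_of, pow_one, pow_zero, mul_one, Cover.pow_eq, Cover.commutator_eq]
      -- The witness records which generator is raised to the power `p`; it is zero for the two
      -- commutator relators.
      · refine ⟨Pi.single 0 1, by simp [Cover.gen], ?_⟩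
        ext i; fin_cases i <;> simp [Cover.gen, pairing, form, powLin]
      · refine ⟨Pi.single 1 1, by simp [Cover.gen], ?_⟩
        ext i; fin_cases i <;> simp [Cover.gen, pairing, form, powLin]
      · refine ⟨Pi.single 2 1, by simp [Cover.gen], ?_⟩
        ext i; fin_cases i <;> simp [Cover.gen, pairing, form, powLin]
      · refine ⟨Pi.single 3 1, by simp [Cover.gen], ?_⟩
        ext i; fin_cases i <;> simp [Cover.gen, pairing, form, powLin]
      · refine ⟨0, by simp, ?_⟩
        ext i; fin_cases i <;> simp [Cover.gen, pairing, form, powLin]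
      · refine ⟨0, by simp, ?_⟩
        ext i; fin_cases i <;> simp [Cover.gen, pairing, form, powLin]

theorem toModel_gen (p : ℕ) (j : Fin 4) : toModel p (gen p j) = (Cover.gen p j : Cover p) :=
  PresentedGroup.toGroup.of _

/-! ### The linear maps compatible with the relations -/

/-- With `s = v 0 + v 1`, `d = v 2`, `e = v 3`, the hypotheses say `powLin v = k • pairing (wVec p)
v`, and the conclusion says that `v` is a multiple of `wVec p`. -/
theorem eq_zero_of_shear {F : Type*} [Field F] {s k d e : F}
    (h1 : s = k * d) (h2 : k * e = 0) (h3 : d = -(k * d)) (h4 : d + e = -(k * e)) :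
    s = 0 ∧ d = 0 ∧ e = 0 := by
  rcases mul_eq_zero.1 h2 with rfl | rfl
  · grind
  · grind

/-- Four vectors `x, y, z, t` that satisfy, as images of the generators, the relations of the
JK-group with a linear power map are the unit vectors or multiples of `(1, -1, 0, 0)`. -/
theorem classify_of_field {F : Type*} [Field F]
    {x0 x1 x2 x3 y0 y1 y2 y3 z0 z1 z2 z3 t0 t1 t2 t3 : F}
    (hx0 : x0 + x1 = x0 * z2 - z0 * x2) (hx1 : 0 = x0 * z3 - z0 * x3)
    (hx2 : x2 = x1 * z2 - z1 * x2) (hx3 : x2 + x3 = x1 * z3 - z1 * x3)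
    (hy0 : y0 + y1 = x0 * z2 - z0 * x2)
    (hy2 : y2 = x1 * z2 - z1 * x2) (hy3 : y2 + y3 = x1 * z3 - z1 * x3)
    (hz0 : z0 + z1 = y0 * (z2 + t2) - (z0 + t0) * y2)
    (hz1 : 0 = y0 * (z3 + t3) - (z0 + t0) * y3)
    (hz2 : z2 = y1 * (z2 + t2) - (z1 + t1) * y2)
    (hz3 : z2 + z3 = y1 * (z3 + t3) - (z1 + t1) * y3)
    (ht0 : t0 + t1 = y0 * t2 - t0 * y2) (ht1 : 0 = y0 * t3 - t0 * y3)
    (ht2 : t2 = y1 * t2 - t1 * y2) (ht3 : t2 + t3 = y1 * t3 - t1 * y3)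
    (a0 : x0 * y2 - y0 * x2 = 0) (a1 : x0 * y3 - y0 * x3 = 0)
    (b0 : z0 * t2 - t0 * z2 = 0) (b1 : z0 * t3 - t0 * z3 = 0)
    (b2 : z1 * t2 - t1 * z2 = 0) (b3 : z1 * t3 - t1 * z3 = 0) :
    ((x0 = 1 ∧ x1 = 0 ∧ x2 = 0 ∧ x3 = 0) ∧ (y0 = 0 ∧ y1 = 1 ∧ y2 = 0 ∧ y3 = 0) ∧
      (z0 = 0 ∧ z1 = 0 ∧ z2 = 1 ∧ z3 = 0) ∧ (t0 = 0 ∧ t1 = 0 ∧ t2 = 0 ∧ t3 = 1)) ∨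
    ((x1 = -x0 ∧ x2 = 0 ∧ x3 = 0) ∧ (y1 = -y0 ∧ y2 = 0 ∧ y3 = 0) ∧
      (z1 = -z0 ∧ z2 = 0 ∧ z3 = 0) ∧ (t1 = -t0 ∧ t2 = 0 ∧ t3 = 0)) := by
  -- The vectors `x` and `y` have the same power, which forces `x - y` to be a multiple of `(1, -1,
  -- 0, 0)`.
  obtain rfl : y2 = x2 := by rw [hy2, ← hx2]
  obtain rfl : y3 = x3 := by linear_combination hy3 - hx3
  have hs : y0 + y1 = x0 + x1 := by rw [hy0, ← hx0]
  by_cases hb : y2 = 0 ∧ y3 = 0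
  · obtain ⟨rfl, rfl⟩ := hb
    simp only [mul_zero, sub_zero, add_zero] at *
    -- If the sum vanishes, `x` and `y` are multiples of `(1, -1, 0, 0)`, and the shear lemma
    -- applies to `t` and then to `z`. Otherwise `x0 * z2 ≠ 0`, and the equations force the unit
    -- vectors.
    by_cases hα : x0 + x1 = 0
    · right
      obtain rfl : x1 = -x0 := by linear_combination hα
      obtain rfl : y1 = -y0 := by linear_combination hs
      obtain ⟨s1, rfl, rfl⟩ := eq_zero_of_shear ht0 ht1.symm (by linear_combination ht2)
        (by linear_combination ht3)
      obtain ⟨r1, rfl, rfl⟩ := eq_zero_of_shear (s := z0 + z1) (k := y0) (d := z2) (e := z3)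
        (by linear_combination hz0) (by linear_combination -hz1) (by linear_combination hz2)
        (by linear_combination hz3)
      obtain rfl : z1 = -z0 := by linear_combination r1
      obtain rfl : t1 = -t0 := by linear_combination s1
      simp
    · left
      obtain rfl : x1 = 0 := by grind
      have h0 : x0 ≠ 0 := by grind
      obtain rfl : z2 = 1 := by grind
      obtain rfl : z3 = 0 := by grind
      have h1 : y1 ≠ 0 := by grind
      obtain rfl : t2 = 0 := by grind
      obtain rfl : t3 = 1 := by grind
      obtain rfl : y1 = 1 := by grind
      obtain rfl : y0 = 0 := by grind
      grind
  · exfalso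
    -- The vectors `x` and `y` commute and share a nonzero `b`-part, so they coincide.
    obtain rfl : y0 = x0 := by
      by_contra h
      have h' : x0 - y0 ≠ 0 := sub_ne_zero.2 (Ne.symm h)
      refine hb ⟨(mul_eq_zero.1 ?_).resolve_left h', (mul_eq_zero.1 ?_).resolve_left h'⟩
      · linear_combination a0
      · linear_combination a1
    obtain rfl : y1 = x1 := by linear_combination hs
    obtain rfl : z2 = t2 + y2 := by linear_combination hz2 - ht2 - hx2
    obtain rfl : z3 = t3 + y3 := by linear_combination hz3 - ht3 - hx3
    -- Since `x = y`, the relations give `z` and `t + y` the same power, so `z = t + y + k (1, -1,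
    -- 0, 0)`.
    obtain ⟨k, rfl⟩ : ∃ k, z0 = t0 + y0 + k := ⟨z0 - t0 - y0, by ring⟩
    obtain rfl : z1 = t1 + y1 - k := by linear_combination hz0 - ht0 - hx0
    -- Substituting this `z` into `pairing z t = 0` turns `pairing y t` into `-k` times the pairing
    -- of `(1, -1, 0, 0)` with `t`.
    obtain ⟨s1, rfl, rfl⟩ := eq_zero_of_shear (s := t0 + t1) (k := -k) (d := t2) (e := t3)
      (by linear_combination ht0 + b0) (by linear_combination -ht1 - b1)
      (by linear_combination ht2 + b2) (by linear_combination ht3 + b3)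
    obtain rfl : t1 = -t0 := by linear_combination s1
    -- Now `t` is `t0` times `(1, -1, 0, 0)`, so `pairing y z` is `k + t0` times the pairing of `y`
    -- with `(1, -1, 0, 0)`; the shear lemma kills the `b`-part of `y`.
    obtain ⟨r1, r2, r3⟩ := eq_zero_of_shear (s := y0 + y1) (k := -(k + t0)) (d := y2) (e := y3)
      (by linear_combination hx0) (by linear_combination -hx1)
      (by linear_combination hx2) (by linear_combination hx3)
    exact hb ⟨r2, r3⟩

/-- The `p`-th power map of the JK-group in coordinates. -/
def powMap (p : ℕ) (x : Fin 4 → ZMod p) : Fin 4 → ZMod p :=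
  powLin x - p.choose 2 • form x x

-- For `p = 2` the power map has a quadratic term, so the linear argument does not apply and the
-- finite check is done directly. Each hypothesis stands before the variables it does not involve,
-- which prunes the search.
set_option synthInstance.maxHeartbeats 400000 in
set_option synthInstance.maxSize 4000 in
set_option maxRecDepth 4000 in
theorem classify_zmod_two : ∀ x0 x1 x2 x3 y0 y1 y2 y3 : ZMod 2,
    x0 * y2 - y0 * x2 = 0 → x0 * y3 - y0 * x3 = 0 →
    x1 * y2 - y1 * x2 = 0 → x1 * y3 - y1 * x3 = 0 →
    x0 + x1 - x0 * x2 = y0 + y1 - y0 * y2 → x0 * x3 = y0 * y3 →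
    x2 - x1 * x2 = y2 - y1 * y2 → x2 + x3 - x1 * x3 = y2 + y3 - y1 * y3 →
    ∀ z0 z1 z2 z3 : ZMod 2,
    x0 + x1 - x0 * x2 = x0 * z2 - z0 * x2 → 0 - x0 * x3 = x0 * z3 - z0 * x3 →
    x2 - x1 * x2 = x1 * z2 - z1 * x2 → x2 + x3 - x1 * x3 = x1 * z3 - z1 * x3 →
    ∀ t0 t1 t2 t3 : ZMod 2,
    z0 + z1 - z0 * z2 = y0 * (z2 + t2) - (z0 + t0) * y2 →
    0 - z0 * z3 = y0 * (z3 + t3) - (z0 + t0) * y3 →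
    z2 - z1 * z2 = y1 * (z2 + t2) - (z1 + t1) * y2 →
    z2 + z3 - z1 * z3 = y1 * (z3 + t3) - (z1 + t1) * y3 →
    t0 + t1 - t0 * t2 = y0 * t2 - t0 * y2 →
    0 - t0 * t3 = y0 * t3 - t0 * y3 →
    t2 - t1 * t2 = y1 * t2 - t1 * y2 →
    t2 + t3 - t1 * t3 = y1 * t3 - t1 * y3 →
    z0 * t2 - t0 * z2 = 0 → z0 * t3 - t0 * z3 = 0 →
    z1 * t2 - t1 * z2 = 0 → z1 * t3 - t1 * z3 = 0 →
    ((x0 = 1 ∧ x1 = 0 ∧ x2 = 0 ∧ x3 = 0) ∧ (y0 = 0 ∧ y1 = 1 ∧ y2 = 0 ∧ y3 = 0) ∧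
      (z0 = 0 ∧ z1 = 0 ∧ z2 = 1 ∧ z3 = 0) ∧ (t0 = 0 ∧ t1 = 0 ∧ t2 = 0 ∧ t3 = 1)) ∨
    ((x1 = -x0 ∧ x2 = 0 ∧ x3 = 0) ∧ (y1 = -y0 ∧ y2 = 0 ∧ y3 = 0) ∧
      (z1 = -z0 ∧ z2 = 0 ∧ z3 = 0) ∧ (t1 = -t0 ∧ t2 = 0 ∧ t3 = 0)) := by
  decide +kernel
/-- Images of the generators satisfying the relations of the JK-group, modulo the center. -/
theorem classify {p : ℕ} [Fact p.Prime] {x y z t : Fin 4 → ZMod p}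
    (hx : powMap p x = pairing x z) (hy : powMap p y = pairing x z)
    (hz : powMap p z = pairing y (z + t)) (ht : powMap p t = pairing y t)
    (hxy : pairing x y = 0) (hzt : pairing z t = 0) :
    (x = Pi.single 0 1 ∧ y = Pi.single 1 1 ∧ z = Pi.single 2 1 ∧ t = Pi.single 3 1) ∨
    ∀ v ∈ ({x, y, z, t} : Set (Fin 4 → ZMod p)), v 1 = -v 0 ∧ v 2 = 0 ∧ v 3 = 0 := by
  have ext_single : ∀ (v : Fin 4 → ZMod p) (j : Fin 4),
      v 0 = (Pi.single j 1 : Fin 4 → ZMod p) 0 ∧ v 1 = (Pi.single j 1 : Fin 4 → ZMod p) 1 ∧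
      v 2 = (Pi.single j 1 : Fin 4 → ZMod p) 2 ∧ v 3 = (Pi.single j 1 : Fin 4 → ZMod p) 3 →
      v = Pi.single j 1 := by
    rintro v j ⟨h0, h1, h2, h3⟩
    ext i; fin_cases i <;> assumption
  simp only [Set.mem_insert_iff, Set.mem_singleton_iff, forall_eq_or_imp, forall_eq]
  suffices h :
      ((x 0 = 1 ∧ x 1 = 0 ∧ x 2 = 0 ∧ x 3 = 0) ∧ (y 0 = 0 ∧ y 1 = 1 ∧ y 2 = 0 ∧ y 3 = 0) ∧
        (z 0 = 0 ∧ z 1 = 0 ∧ z 2 = 1 ∧ z 3 = 0) ∧ (t 0 = 0 ∧ t 1 = 0 ∧ t 2 = 0 ∧ t 3 = 1)) ∨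
      ((x 1 = -x 0 ∧ x 2 = 0 ∧ x 3 = 0) ∧ (y 1 = -y 0 ∧ y 2 = 0 ∧ y 3 = 0) ∧
        (z 1 = -z 0 ∧ z 2 = 0 ∧ z 3 = 0) ∧ (t 1 = -t 0 ∧ t 2 = 0 ∧ t 3 = 0)) from
    h.imp_left fun h => ⟨ext_single x 0 h.1, ext_single y 1 h.2.1,
      ext_single z 2 h.2.2.1, ext_single t 3 h.2.2.2⟩
  obtain rfl | hp := eq_or_ne p 2
  · have key : ∀ v : Fin 4 → ZMod 2, powMap 2 v = powLin v - form v v := fun v => by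
      rw [powMap, Nat.choose_self, one_smul]
    rw [key] at hx hy hz ht
    have h := hx.trans hy.symm
    exact classify_zmod_two _ _ _ _ _ _ _ _
      (congrFun hxy 0) (congrFun hxy 1) (congrFun hxy 2) (congrFun hxy 3)
      (congrFun h 0) (neg_injective (by simpa [powLin, form] using congrFun h 1))
      (congrFun h 2) (congrFun h 3) _ _ _ _
      (congrFun hx 0) (congrFun hx 1) (congrFun hx 2) (congrFun hx 3) _ _ _ _
      (congrFun hz 0) (congrFun hz 1) (congrFun hz 2) (congrFun hz 3)
      (congrFun ht 0) (congrFun ht 1) (congrFun ht 2) (congrFun ht 3)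
      (congrFun hzt 0) (congrFun hzt 1) (congrFun hzt 2) (congrFun hzt 3)
  · have hc : (p.choose 2 : ZMod p) = 0 := by
      have hp2 : 2 < p := lt_of_le_of_ne (Fact.out : p.Prime).two_le hp.symm
      exact (ZMod.natCast_eq_zero_iff _ _).2
        ((Fact.out : p.Prime).dvd_choose_self two_ne_zero hp2)
    have key : ∀ v : Fin 4 → ZMod p, powMap p v = powLin v := fun v => by
      rw [powMap, ← Nat.cast_smul_eq_nsmul (ZMod p), hc, zero_smul, sub_zero]
    rw [key] at hx hy hz ht
    exact classify_of_field (congrFun hx 0) (congrFun hx 1) (congrFun hx 2) (congrFun hx 3)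
      (congrFun hy 0) (congrFun hy 2) (congrFun hy 3)
      (congrFun hz 0) (congrFun hz 1) (congrFun hz 2) (congrFun hz 3)
      (congrFun ht 0) (congrFun ht 1) (congrFun ht 2) (congrFun ht 3)
      (congrFun hxy 0) (congrFun hxy 1)
      (congrFun hzt 0) (congrFun hzt 1) (congrFun hzt 2) (congrFun hzt 3)

/-! ### Class-two computations in the JK-group -/

theorem zpow_mul_zpow_of_eq {H : Type*} [Group H] {x y c : H} (h : y * x = x * y * c)
    (hx : Commute x c) (hy : Commute y c) (m n : ℤ) :
    y ^ n * x ^ m = x ^ m * y ^ n * c ^ (n * m) := by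
  have h1 : SemiconjBy x (y * c) y := by
    rw [SemiconjBy, h, mul_assoc]
  have h2 := h1.zpow_right n
  rw [hy.mul_zpow] at h2
  have h3 : SemiconjBy (y ^ n) x (x * c ^ n) := by
    rw [SemiconjBy, ← h2.eq, mul_assoc, (hy.zpow_zpow n n).eq]
  have h4 := h3.zpow_right m
  rw [(hx.zpow_right n).mul_zpow, ← zpow_mul] at h4
  rw [h4.eq, mul_assoc, mul_assoc, (hy.zpow_zpow n (n * m)).eq]

/-- This is the collection process in class two: moving `a'`, `b'` to the left past `c`, `d` leaves
only the central corrections `k₁, …, k₄`. -/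
theorem collect {H : Type*} [Group H] {a b c d a' b' c' d' z z' k₁ k₂ k₃ k₄ : H}
    (hz : z ∈ Subgroup.center H) (h₁ : k₁ ∈ Subgroup.center H) (h₂ : k₂ ∈ Subgroup.center H)
    (h₃ : k₃ ∈ Subgroup.center H) (h₄ : k₄ ∈ Subgroup.center H)
    (hba : b * a' = a' * b) (hdc : d * c' = c' * d)
    (hca : c * a' = a' * c * k₁) (hda : d * a' = a' * d * k₂)
    (hcb : c * b' = b' * c * k₃) (hdb : d * b' = b' * d * k₄) :
    a * b * c * d * z * (a' * b' * c' * d' * z') =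
      a * a' * (b * b') * (c * c') * (d * d') * (z * z' * (k₁ * k₂ * k₃ * k₄)) := by
  have hz := Subgroup.mem_center_iff.1 hz
  have h₁ := Subgroup.mem_center_iff.1 h₁
  have h₂ := Subgroup.mem_center_iff.1 h₂
  have h₃ := Subgroup.mem_center_iff.1 h₃
  have h₄ := Subgroup.mem_center_iff.1 h₄
  have e₁ : c * d * (a' * b') = a' * b' * (c * d) * (k₁ * k₂ * k₃ * k₄) := by
    calc c * d * (a' * b') = c * (d * a') * b' := by group
      _ = c * a' * d * (k₂ * b') := by rw [hda]; group
      _ = a' * c * k₁ * (d * b') * k₂ := by rw [← h₂, hca]; group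
      _ = a' * c * (k₁ * (b' * d)) * k₄ * k₂ := by rw [hdb]; group
      _ = a' * (c * b') * d * (k₁ * k₄ * k₂) := by rw [← h₁]; group
      _ = a' * b' * c * (k₃ * (d * (k₁ * k₄ * k₂))) := by rw [hcb]; group
      _ = a' * b' * (c * d) * (k₁ * ((k₄ * k₂) * k₃)) := by rw [← h₃]; group
      _ = a' * b' * (c * d) * (k₁ * k₂ * k₃ * k₄) := by rw [← h₄ k₂, mul_assoc k₂, ← h₄ k₃]; group
  have hk : ∀ g, g * (k₁ * k₂ * k₃ * k₄) = (k₁ * k₂ * k₃ * k₄) * g := by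
    intro g
    rw [← mul_assoc, ← mul_assoc, ← mul_assoc, h₁ g, mul_assoc k₁, h₂ g, ← mul_assoc,
      mul_assoc _ g, h₃ g, ← mul_assoc, mul_assoc _ g, h₄ g, ← mul_assoc]
  generalize k₁ * k₂ * k₃ * k₄ = k at *
  calc a * b * c * d * z * (a' * b' * c' * d' * z')
      = a * b * (c * d) * (z * (a' * b' * c' * d')) * z' := by group
    _ = a * b * (c * d * (a' * b')) * (c' * d') * (z * z') := by rw [← hz]; group
    _ = a * (b * a') * b' * c * d * (k * (c' * d' * (z * z'))) := by rw [e₁]; group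
    _ = a * a' * (b * b') * c * (d * c') * d' * (z * z' * k) := by rw [← hk, hba]; group
    _ = _ := by rw [hdc]; group

theorem commutator_commutator {p : ℕ} (u v t : G p) : ⁅⁅u, v⁆, t⁆ = 1 := by
  obtain ⟨u, rfl⟩ := PresentedGroup.mk_surjective _ u
  obtain ⟨v, rfl⟩ := PresentedGroup.mk_surjective _ v
  obtain ⟨t, rfl⟩ := PresentedGroup.mk_surjective _ t
  simp only [← map_commutatorElement]
  exact PresentedGroup.one_of_mem (Or.inl ⟨u, v, t, rfl⟩)

theorem commutator_mem_center {p : ℕ} (u v : G p) : ⁅u, v⁆ ∈ Subgroup.center (G p) :=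
  Subgroup.mem_center_iff.2 fun g =>
    (commutatorElement_eq_one_iff_mul_comm.1 (commutator_commutator u v g)).symm

theorem end_ext {p : ℕ} {f g : Monoid.End (G p)} (h : ∀ j, f (gen p j) = g (gen p j)) : f = g :=
  PresentedGroup.ext h

section

variable (p : ℕ)

theorem gen_eq_mk (j : Fin 4) : gen p j = PresentedGroup.mk (relators p 1 0) (letter j) := rfl

theorem gen_zero_pow : gen p 0 ^ p = centerBasis p 0 := by
  have h : PresentedGroup.mk (relators p 1 0) (letter 0 ^ p * ⁅letter 0, letter 2⁆⁻¹) = 1 :=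
    PresentedGroup.one_of_mem (Or.inr (by simp))
  simp only [map_mul, map_inv, map_pow, map_commutatorElement, ← gen_eq_mk] at h
  exact mul_inv_eq_one.1 h

theorem gen_one_pow : gen p 1 ^ p = centerBasis p 0 := by
  have h : PresentedGroup.mk (relators p 1 0)
      (letter 1 ^ p * ⁅letter 0, letter 2 ^ 1 * letter 3 ^ 0⁆⁻¹) = 1 :=
    PresentedGroup.one_of_mem (Or.inr (by simp))
  simp only [map_mul, map_inv, map_pow, map_commutatorElement, ← gen_eq_mk, pow_one, pow_zero,
    mul_one] at h
  exact mul_inv_eq_one.1 h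

theorem gen_two_pow_eq_commutator : gen p 2 ^ p = ⁅gen p 1, gen p 2 * gen p 3⁆ := by
  have h : PresentedGroup.mk (relators p 1 0)
      (letter 2 ^ p * ⁅letter 1, letter 2 * letter 3⁆⁻¹) = 1 :=
    PresentedGroup.one_of_mem (Or.inr (by simp))
  simp only [map_mul, map_inv, map_pow, map_commutatorElement, ← gen_eq_mk] at h
  exact mul_inv_eq_one.1 h

theorem gen_three_pow : gen p 3 ^ p = centerBasis p 3 := by
  have h : PresentedGroup.mk (relators p 1 0) (letter 3 ^ p * ⁅letter 1, letter 3⁆⁻¹) = 1 :=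
    PresentedGroup.one_of_mem (Or.inr (by simp))
  simp only [map_mul, map_inv, map_pow, map_commutatorElement, ← gen_eq_mk] at h
  exact mul_inv_eq_one.1 h

theorem commute_gen_zero_one : Commute (gen p 0) (gen p 1) := by
  have h : PresentedGroup.mk (relators p 1 0) ⁅letter 0, letter 1⁆ = 1 :=
    PresentedGroup.one_of_mem (Or.inr (by simp))
  simp only [map_commutatorElement, ← gen_eq_mk] at h
  exact commutatorElement_eq_one_iff_mul_comm.1 h

theorem commute_gen_two_three : Commute (gen p 2) (gen p 3) := by
  have h : PresentedGroup.mk (relators p 1 0) ⁅letter 2, letter 3⁆ = 1 :=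
    PresentedGroup.one_of_mem (Or.inr (by simp))
  simp only [map_commutatorElement, ← gen_eq_mk] at h
  exact commutatorElement_eq_one_iff_mul_comm.1 h

theorem gen_two_pow : gen p 2 ^ p = centerBasis p 2 * centerBasis p 3 := by
  have h := Subgroup.mem_center_iff.1 (commutator_mem_center (gen p 1) (gen p 3)) (gen p 2)
  rw [gen_two_pow_eq_commutator]
  change _ = ⁅gen p 1, gen p 2⁆ * ⁅gen p 1, gen p 3⁆
  calc ⁅gen p 1, gen p 2 * gen p 3⁆ = ⁅gen p 1, gen p 2⁆ *
        (gen p 2 * ⁅gen p 1, gen p 3⁆ * (gen p 2)⁻¹) := by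
          simp only [commutatorElement_def]; group
    _ = _ := by rw [h]; group

theorem centerBasis_mem_center (i : Fin 4) : centerBasis p i ∈ Subgroup.center (G p) := by
  fin_cases i <;> exact commutator_mem_center _ _

theorem gen_pow_mem_center (j : Fin 4) : gen p j ^ p ∈ Subgroup.center (G p) := by
  fin_cases j
  · exact gen_zero_pow p ▸ centerBasis_mem_center p 0
  · exact gen_one_pow p ▸ centerBasis_mem_center p 0
  · exact gen_two_pow p ▸ mul_mem (centerBasis_mem_center p 2) (centerBasis_mem_center p 3)
  · exact gen_three_pow p ▸ centerBasis_mem_center p 3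

/-- In class two `⁅x, y⁆ ^ p = ⁅x ^ p, y⁆`, which is trivial when `x ^ p` is central. -/
theorem commutator_pow_eq_one {p : ℕ} {x : G p} (hx : x ^ p ∈ Subgroup.center (G p)) (y : G p) :
    ⁅x, y⁆ ^ p = 1 := by
  have hc := Subgroup.mem_center_iff.1 (commutator_mem_center x y)
  have h := zpow_mul_zpow_of_eq (x := y) (y := x) (c := ⁅x, y⁆)
    (by rw [hc]; simp only [commutatorElement_def]; group) (hc y) (hc x) 1 p
  rw [zpow_natCast, zpow_one, mul_one, zpow_natCast] at h
  rw [← Subgroup.mem_center_iff.1 hx y] at h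
  simpa using h

theorem centerBasis_pow (i : Fin 4) : centerBasis p i ^ p = 1 := by
  fin_cases i <;> exact commutator_pow_eq_one (gen_pow_mem_center p _) _

theorem pow_val_add {H : Type*} [Monoid H] {p : ℕ} [NeZero p] {c : H} (hc : c ^ p = 1)
    (s t : ZMod p) : c ^ (s + t).val = c ^ s.val * c ^ t.val := by
  rw [ZMod.val_add, ← pow_add, ← pow_eq_pow_mod _ hc]

end

/-! ### Central elements in coordinates and the covering map -/

variable (p : ℕ) [Fact p.Prime]

/-- The elements of `centerBasis`, in the center. -/
def centerGen (p : ℕ) (i : Fin 4) : Subgroup.center (G p) :=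
  ⟨centerBasis p i, centerBasis_mem_center p i⟩

theorem centerGen_pow (p : ℕ) (i : Fin 4) : centerGen p i ^ p = 1 :=
  Subtype.ext (centerBasis_pow p i)

open scoped IsMulCommutative in
/-- The central element with given coordinates with respect to `centerBasis`, as a homomorphism. -/
def czHom : Multiplicative (Fin 4 → ZMod p) →* G p :=
  (Subgroup.center (G p)).subtype.comp
    { toFun := fun z => ∏ i, centerGen p i ^ (z.toAdd i).val
      map_one' := by simp
      map_mul' := fun x y => by
        simp [pow_val_add (centerGen_pow p _), Finset.prod_mul_distrib] }

/-- The central element with given coordinates with respect to `centerBasis`. -/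
def cz (z : Fin 4 → ZMod p) : G p := czHom p (Multiplicative.ofAdd z)

open scoped IsMulCommutative in
theorem cz_eq (z : Fin 4 → ZMod p) : cz p z =
    centerBasis p 0 ^ (z 0).val * centerBasis p 1 ^ (z 1).val *
    centerBasis p 2 ^ (z 2).val * centerBasis p 3 ^ (z 3).val := by
  simp [cz, czHom, Fin.prod_univ_four, centerGen]

theorem cz_mem_center (z : Fin 4 → ZMod p) : cz p z ∈ Subgroup.center (G p) := by
  simp only [cz, czHom, MonoidHom.comp_apply]
  exact Subtype.property _

@[simp] theorem cz_zero : cz p 0 = 1 := map_one (czHom p)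

theorem cz_add (x y : Fin 4 → ZMod p) : cz p (x + y) = cz p x * cz p y :=
  map_mul (czHom p) (Multiplicative.ofAdd x) (Multiplicative.ofAdd y)

theorem cz_neg (x : Fin 4 → ZMod p) : cz p (-x) = (cz p x)⁻¹ :=
  map_inv (czHom p) (Multiplicative.ofAdd x)

theorem cz_zsmul (n : ℤ) (x : Fin 4 → ZMod p) : cz p (n • x) = cz p x ^ n :=
  map_zpow (czHom p) (Multiplicative.ofAdd x) n

theorem mul_cz (g : G p) (z : Fin 4 → ZMod p) : g * cz p z = cz p z * g :=
  Subgroup.mem_center_iff.1 (cz_mem_center p z) g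

theorem centerBasis_eq_cz (i : Fin 4) : centerBasis p i = cz p (Pi.single i 1) := by
  have : Fact (1 < p) := ⟨(Fact.out : p.Prime).one_lt⟩
  rw [cz_eq]
  fin_cases i <;> simp [ZMod.val_one]

theorem gen_pow_eq_cz (j : Fin 4) : gen p j ^ p = cz p (powLin (Pi.single j 1)) := by
  fin_cases j
  · refine (gen_zero_pow p).trans ((centerBasis_eq_cz p 0).trans (congrArg _ ?_))
    ext i; fin_cases i <;> simp [powLin]
  · refine (gen_one_pow p).trans ((centerBasis_eq_cz p 0).trans (congrArg _ ?_))
    ext i; fin_cases i <;> simp [powLin]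
  · refine (gen_two_pow p).trans ?_
    rw [centerBasis_eq_cz, centerBasis_eq_cz, ← cz_add]
    congr 1
    ext i; fin_cases i <;> simp [powLin]
  · refine (gen_three_pow p).trans ((centerBasis_eq_cz p 3).trans (congrArg _ ?_))
    ext i; fin_cases i <;> simp [powLin]

theorem gen_mul_gen {i j k : Fin 4} (h : ⁅gen p i, gen p j⁆ = centerBasis p k) (m n : ℤ) :
    gen p j ^ n * gen p i ^ m =
      gen p i ^ m * gen p j ^ n * cz p (-((n * m : ℤ) • (Pi.single k 1 : Fin 4 → ZMod p))) := by
  rw [cz_neg, cz_zsmul, ← inv_zpow, ← cz_neg]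
  rw [centerBasis_eq_cz] at h
  refine zpow_mul_zpow_of_eq ?_ (mul_cz p _ _) (mul_cz p _ _) m n
  rw [cz_neg, ← h, eq_mul_inv_iff_mul_eq,
    Subgroup.mem_center_iff.1 (commutator_mem_center (gen p i) (gen p j))]
  simp only [commutatorElement_def]
  group

/-- The quotient map from the covering group to the JK-group. -/
def ofCover : Cover p →* G p :=
  MonoidHom.mk' (fun h => gen p 0 ^ h.vec 0 * gen p 1 ^ h.vec 1 * gen p 2 ^ h.vec 2 *
    gen p 3 ^ h.vec 3 * cz p h.cen) <| fun x y => by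
    simp only [Cover.mul_vec, Pi.add_apply, zpow_add, Cover.mul_cen]
    rw [collect (cz_mem_center p _) (cz_mem_center p _) (cz_mem_center p _) (cz_mem_center p _)
      (cz_mem_center p _) ((commute_gen_zero_one p).symm.zpow_zpow _ _).eq
      ((commute_gen_two_three p).symm.zpow_zpow _ _).eq
      (gen_mul_gen p (k := 0) rfl _ _) (gen_mul_gen p (k := 1) rfl _ _)
      (gen_mul_gen p (k := 2) rfl _ _) (gen_mul_gen p (k := 3) rfl _ _)]
    simp only [← cz_add]
    congr 2
    ext i
    fin_cases i <;> simp [form] <;> ring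

theorem ofCover_apply (h : Cover p) : ofCover p h =
    gen p 0 ^ h.vec 0 * gen p 1 ^ h.vec 1 * gen p 2 ^ h.vec 2 * gen p 3 ^ h.vec 3 *
      cz p h.cen := rfl

theorem ofCover_gen (j : Fin 4) : ofCover p (Cover.gen p j) = gen p j := by
  rw [ofCover_apply]
  fin_cases j <;> simp [Cover.gen]

theorem ofCover_zero (z : Fin 4 → ZMod p) : ofCover p ⟨0, z⟩ = cz p z := by
  simp [ofCover_apply]

theorem ofCover_surjective : Function.Surjective (ofCover p) := by
  rw [← MonoidHom.range_eq_top, eq_top_iff, ← PresentedGroup.closure_range_of,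
    Subgroup.closure_le]
  rintro _ ⟨j, rfl⟩
  exact ⟨_, ofCover_gen p j⟩

theorem ofCover_smul (u : Fin 4 → ℤ) (z : Fin 4 → ZMod p) :
    ofCover p ⟨p • u, z⟩ = cz p (powLin (red p u) + z) := by
  have h : ∀ j, gen p j ^ (p • u) j = cz p (u j • powLin (Pi.single j 1)) := fun j => by
    rw [cz_zsmul, ← gen_pow_eq_cz, ← zpow_natCast, ← zpow_mul]
    simp
  rw [ofCover_apply, h, h, h, h]
  simp only [← cz_add]
  congr 1
  ext i
  fin_cases i <;> simp [powLin]

theorem Cover.gen_zpow (j : Fin 4) (n : ℤ) :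
    Cover.gen p j ^ n = ⟨n • Pi.single j 1, 0⟩ := by
  have h : form (red p (Pi.single j 1)) (red p (Pi.single j 1)) = 0 := by
    ext i; fin_cases j <;> fin_cases i <;> simp [form]
  have h' : ∀ n : ℕ, Cover.gen p j ^ n = ⟨n • Pi.single j 1, 0⟩ := fun n => by
    rw [Cover.pow_eq]
    simp only [Cover.gen, h, smul_zero, sub_zero]
  cases n with
  | ofNat n =>
    rw [Int.ofNat_eq_natCast, zpow_natCast, h']
    simp
  | negSucc n =>
    rw [zpow_negSucc, h']
    apply Cover.ext
    · simp [Int.negSucc_eq]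
      ring
    · have : form (red p ((n + 1) • Pi.single j 1)) (red p ((n + 1) • Pi.single j 1)) = 0 := by
        ext i; fin_cases j <;> fin_cases i <;> simp [form]
      simp only [Cover.inv_cen, this]
      simp

/-- Writing an element as a word in the generators lets the composite of `ofCover` and `toModel` be
recognized as the quotient map. -/
theorem Cover.eq_prod (h : Cover p) : h =
    Cover.gen p 0 ^ h.vec 0 * Cover.gen p 1 ^ h.vec 1 * Cover.gen p 2 ^ h.vec 2 *
      Cover.gen p 3 ^ h.vec 3 *
      (⁅Cover.gen p 0, Cover.gen p 2⁆ ^ (h.cen 0).val *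
        ⁅Cover.gen p 0, Cover.gen p 3⁆ ^ (h.cen 1).val *
        ⁅Cover.gen p 1, Cover.gen p 2⁆ ^ (h.cen 2).val *
        ⁅Cover.gen p 1, Cover.gen p 3⁆ ^ (h.cen 3).val) := by
  simp only [Cover.gen_zpow, Cover.commutator_eq, Cover.pow_eq]
  apply Cover.ext
  · ext i; fin_cases i <;> simp
  · ext i; fin_cases i <;> simp [form, pairing, Cover.gen]

theorem toModel_ofCover (h : Cover p) : toModel p (ofCover p h) = (h : Cover p ⧸ _) := by
  have e := congrArg (QuotientGroup.mk' (Cover.relSubgroup p)) (Cover.eq_prod p h)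
  simp only [map_mul, map_zpow, map_pow, map_commutatorElement, QuotientGroup.mk'_apply] at e
  rw [ofCover_apply, cz_eq]
  simp only [map_mul, map_zpow, map_pow, toModel_gen, centerBasis, Matrix.cons_val,
    map_commutatorElement]
  exact e.symm

/-! ### Coordinates modulo the center -/

/-- The coordinates of an element modulo the center, as a homomorphism. -/
def vbHom : G p →* Multiplicative (Fin 4 → ZMod p) :=
  PresentedGroup.toGroup (f := fun j => Multiplicative.ofAdd (Pi.single j 1)) <| by
    have hpow : ∀ x : Multiplicative (Fin 4 → ZMod p), x ^ p = 1 := fun x => by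
      rw [← ofAdd_toAdd x, ← ofAdd_nsmul, ← ofAdd_zero]
      congr 1
      ext i
      simp
    have hcomm : ∀ x y : Multiplicative (Fin 4 → ZMod p), ⁅x, y⁆ = 1 := fun x y =>
      commutatorElement_eq_one_iff_mul_comm.2 (mul_comm x y)
    rintro r (⟨u, v, t, rfl⟩ | hr)
    · rw [map_commutatorElement, hcomm]
    · simp only [Set.mem_insert_iff, Set.mem_singleton_iff] at hr
      rcases hr with rfl | rfl | rfl | rfl | rfl | rfl <;>
        simp only [map_mul, map_inv, map_pow, map_commutatorElement, hpow, hcomm, inv_one, mul_one]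

/-- The coordinates of an element modulo the center. -/
def vb (g : G p) : Fin 4 → ZMod p := (vbHom p g).toAdd

@[simp] theorem vb_gen (j : Fin 4) : vb p (gen p j) = Pi.single j 1 := by
  rw [vb, vbHom, gen, PresentedGroup.toGroup.of, toAdd_ofAdd]

@[simp] theorem vb_mul (g h : G p) : vb p (g * h) = vb p g + vb p h := by simp [vb]

@[simp] theorem vb_inv (g : G p) : vb p g⁻¹ = -vb p g := by simp [vb]

@[simp] theorem vb_pow (g : G p) (n : ℕ) : vb p (g ^ n) = n • vb p g := by simp [vb]

@[simp] theorem vb_zpow (g : G p) (n : ℤ) : vb p (g ^ n) = n • vb p g := by simp [vb]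

@[simp] theorem vb_commutator (g h : G p) : vb p ⁅g, h⁆ = 0 := by
  simp [commutatorElement_def]

@[simp] theorem vb_cz (z : Fin 4 → ZMod p) : vb p (cz p z) = 0 := by
  simp [cz_eq, centerBasis]

theorem vb_ofCover (h : Cover p) : vb p (ofCover p h) = red p h.vec := by
  ext i
  rw [ofCover_apply]
  fin_cases i <;> simp

theorem cz_injective : Function.Injective (cz p) := by
  have h : ∀ z, cz p z = 1 → z = 0 := fun z hz => by
    rw [← ofCover_zero] at hz
    have := (toModel_ofCover p ⟨0, z⟩).symm
    rw [hz, map_one, QuotientGroup.eq_one_iff] at this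
    exact Cover.mk_zero_mem_relSubgroup.1 this
  intro x y hxy
  refine sub_eq_zero.1 (h _ ?_)
  rw [sub_eq_add_neg, cz_add, cz_neg, hxy, mul_inv_cancel]

/-- A lift to `Cover p` has vector part divisible by `p`, and `p`-th powers of the generators are
central by the relations. -/
theorem exists_eq_cz {g : G p} (hg : vb p g = 0) : ∃ z, g = cz p z := by
  obtain ⟨h, rfl⟩ := ofCover_surjective p g
  rw [vb_ofCover] at hg
  have hd : ∀ i, ∃ u : ℤ, h.vec i = p * u := fun i =>
    (ZMod.intCast_zmod_eq_zero_iff_dvd _ _).1 (congrFun hg i)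
  choose u hu using hd
  refine ⟨_, (congrArg (ofCover p) (?_ : h = ⟨p • u, h.cen⟩)).trans (ofCover_smul p u h.cen)⟩
  apply Cover.ext
  · ext i; simp [hu]
  · rfl

theorem pow_prime_eq_cz (g : G p) : g ^ p = cz p (powMap p (vb p g)) := by
  obtain ⟨h, rfl⟩ := ofCover_surjective p g
  rw [← map_pow, Cover.pow_eq, ofCover_smul, vb_ofCover, powMap]
  congr 1
  have : p • h.cen = 0 := by ext; simp
  rw [this, zero_sub, sub_eq_add_neg]

theorem commutator_eq_cz (g h : G p) : ⁅g, h⁆ = cz p (pairing (vb p g) (vb p h)) := by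
  obtain ⟨g, rfl⟩ := ofCover_surjective p g
  obtain ⟨h, rfl⟩ := ofCover_surjective p h
  rw [← map_commutatorElement, Cover.commutator_eq, ofCover_zero, vb_ofCover, vb_ofCover]

theorem exists_eq_cz_of_mem_center {g : G p} (hg : g ∈ Subgroup.center (G p)) :
    ∃ z, g = cz p z := by
  -- Pairing with `b₁` and with `a₁` already reads off all four coordinates of `g`.
  have h : ∀ j, pairing (vb p g) (Pi.single j 1) = 0 := fun j => by
    apply cz_injective
    rw [← vb_gen, ← commutator_eq_cz, cz_zero]
    exact commutatorElement_eq_one_iff_mul_comm.2 (Subgroup.mem_center_iff.1 hg _).symm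
  apply exists_eq_cz
  ext i
  fin_cases i
  · simpa [pairing, form] using congrFun (h 2) 0
  · simpa [pairing, form] using congrFun (h 2) 2
  · simpa [pairing, form] using congrFun (h 0) 0
  · simpa [pairing, form] using congrFun (h 0) 1

/-- The coordinates of `a₁ a₂⁻¹`. -/
def wVec (p : ℕ) : Fin 4 → ZMod p := ![1, -1, 0, 0]

@[simp] theorem vb_w : vb p (w p) = wVec p := by
  ext i; fin_cases i <;> simp [w, wVec]

/-- Both `powLin` and the quadratic term vanish at `wVec p`. This makes exponents of `w` in `𝔽_p`
meaningful and hence `wEnd` a homomorphism. -/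
theorem w_pow : w p ^ p = 1 := by
  rw [pow_prime_eq_cz, vb_w, ← cz_zero]
  congr 1
  ext i; fin_cases i <;> simp [powMap, powLin, form, wVec]

/-! ### Representatives -/

theorem vb_rep (k : Fin 4 → ℕ) :
    vb p (w p ^ k 0 * gen p 1 ^ k 1 * gen p 2 ^ k 2 * gen p 3 ^ k 3) =
      ![(k 0 : ZMod p), k 1 - k 0, k 2, k 3] := by
  ext i
  simp only [vb_mul, vb_pow, vb_w, vb_gen, Pi.add_apply, Pi.smul_apply]
  fin_cases i <;> simp [wVec]
  ring

theorem eq_of_mem_reps {x y : G p} (hx : x ∈ reps p) (hy : y ∈ reps p)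
    (h : vb p x = vb p y) : x = y := by
  obtain ⟨k, hk, rfl⟩ := hx
  obtain ⟨l, hl, rfl⟩ := hy
  have inj : ∀ i, (k i : ZMod p) = l i → k i = l i := fun i hi => by
    rw [ZMod.natCast_eq_natCast_iff'] at hi
    rwa [Nat.mod_eq_of_lt (hk i), Nat.mod_eq_of_lt (hl i)] at hi
  rw [vb_rep, vb_rep] at h
  have h0 : (k 0 : ZMod p) = l 0 := congrFun h 0
  have h1 : (k 1 : ZMod p) - k 0 = l 1 - l 0 := congrFun h 1
  have h1 : (k 1 : ZMod p) = l 1 := by rwa [h0, sub_left_inj] at h1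
  have h2 : (k 2 : ZMod p) = l 2 := congrFun h 2
  have h3 : (k 3 : ZMod p) = l 3 := congrFun h 3
  rw [inj 0 h0, inj 1 h1, inj 2 h2, inj 3 h3]

theorem w_pow_mem_reps {n : ℕ} (hn : n < p) : w p ^ n ∈ reps p := by
  refine ⟨![n, 0, 0, 0], fun i => ?_, by simp⟩
  have := (Fact.out : p.Prime).pos
  fin_cases i <;> simpa

theorem gen_mem_reps (j : Fin 4) : gen p j ∈ reps p := by
  have h0 := (Fact.out : p.Prime).pos
  have h1 := (Fact.out : p.Prime).one_lt
  fin_cases j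
  -- Here `a₁ = (a₁a₂⁻¹) a₂`.
  · exact ⟨![1, 1, 0, 0], fun i => by fin_cases i <;> simpa, by simp [w]⟩
  · exact ⟨![0, 1, 0, 0], fun i => by fin_cases i <;> simpa, by simp⟩
  · exact ⟨![0, 0, 1, 0], fun i => by fin_cases i <;> simpa, by simp⟩
  · exact ⟨![0, 0, 0, 1], fun i => by fin_cases i <;> simpa, by simp⟩

/-! ### Endomorphisms -/

/-- The linear functional with coefficient vector `x`. -/
def S.dot {p : ℕ} (x : S p) (v : Fin 4 → ZMod p) : ZMod p := ∑ j, x j * v j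

theorem S.dot_add {p : ℕ} (x : S p) (u v : Fin 4 → ZMod p) :
    x.dot (u + v) = x.dot u + x.dot v := by
  simp [S.dot, mul_add, Finset.sum_add_distrib]

theorem S.dot_smul {p : ℕ} (x : S p) (c : ZMod p) (v : Fin 4 → ZMod p) :
    x.dot (c • v) = c * x.dot v := by
  simp only [S.dot, Pi.smul_apply, smul_eq_mul, Finset.mul_sum, mul_left_comm]

theorem S.dot_zero {p : ℕ} (x : S p) : x.dot 0 = 0 := by
  simp [S.dot]

theorem S.dot_single {p : ℕ} (x : S p) (j : Fin 4) : x.dot (Pi.single j 1) = x j := by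
  simp only [S.dot, Fin.sum_univ_four]
  fin_cases j <;> simp

theorem S.dot_wVec {p : ℕ} (x : S p) : x.dot (wVec p) = x 0 - x 1 := by
  simp [S.dot, Fin.sum_univ_four, wVec, sub_eq_add_neg]

theorem S.mul_dot {p : ℕ} (x y : S p) (v : Fin 4 → ZMod p) :
    (x * y).dot v = (x 0 - x 1) * y.dot v := by
  simp only [S.dot, S.mul_apply, Finset.mul_sum, mul_assoc]

/-- The endomorphism mapping each generator to a power of `a₁ a₂⁻¹`. -/
def wEnd (x : S p) : Monoid.End (G p) :=
  MonoidHom.mk' (fun g => w p ^ (x.dot (vb p g)).val) fun g h => by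
    rw [vb_mul, S.dot_add, pow_val_add (w_pow p)]

theorem wEnd_apply (x : S p) (g : G p) :
    wEnd p x g = w p ^ (x.dot (vb p g)).val := rfl

theorem vb_wEnd (x : S p) (g : G p) :
    vb p (wEnd p x g) = x.dot (vb p g) • wVec p := by
  rw [wEnd_apply, vb_pow, vb_w, ← Nat.cast_smul_eq_nsmul (ZMod p), ZMod.natCast_zmod_val]

/-- The normalized endomorphisms, indexed by `S_p¹`. -/
def nrm : S1 p →* Monoid.End (G p) :=
  WithOne.lift
    { toFun := wEnd p
      map_mul' := fun x y => by
        ext g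
        change wEnd p (x * y) g = wEnd p x (wEnd p y g)
        rw [wEnd_apply, wEnd_apply p x, vb_wEnd, S.dot_smul, S.mul_dot, S.dot_wVec, mul_comm] }

theorem nrm_coe (x : S p) : nrm p (x : S1 p) = wEnd p x := rfl

theorem wEnd_gen (x : S p) (j : Fin 4) : wEnd p x (gen p j) = w p ^ (x j).val := by
  rw [wEnd_apply, vb_gen, S.dot_single]

theorem isNormalized_nrm (s : S1 p) : IsNormalized (nrm p s) := by
  intro j
  induction s using WithOne.recOneCoe with
  | one => exact gen_mem_reps p j
  | coe x =>
    rw [nrm_coe, wEnd_gen]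
    exact w_pow_mem_reps p (ZMod.val_lt _)

theorem wEnd_ne_one (x : S p) : wEnd p x ≠ 1 := by
  intro h
  have := congrArg (vb p) (DFunLike.congr_fun h (gen p 2))
  rw [vb_wEnd, Monoid.End.coe_one, id, vb_gen] at this
  simpa [wVec] using congrFun this 2

theorem isVec_iff_eq_nrm {n : Monoid.End (G p)} {v : S1 p} : IsVec n v ↔ n = nrm p v := by
  constructor
  · rintro (⟨rfl, rfl⟩ | ⟨-, x, rfl, hx⟩)
    · exact (map_one _).symm
    · exact end_ext fun j => (hx j).trans (wEnd_gen p x j).symm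
  · rintro rfl
    induction v using WithOne.recOneCoe with
    | one => exact Or.inl ⟨map_one _, rfl⟩
    | coe x => exact Or.inr ⟨wEnd_ne_one p x, x, rfl, wEnd_gen p x⟩

/-- The identity is told apart from every `wEnd p x` by the `b₁`-coordinate of the image of `b₁`. -/
theorem nrm_injective_of_vb {s t : S1 p}
    (h : ∀ j, vb p (nrm p s (gen p j)) = vb p (nrm p t (gen p j))) : s = t := by
  have key : ∀ x : S p, ∀ h : ∀ j, vb p (nrm p 1 (gen p j)) = vb p (nrm p x (gen p j)),
      False := fun x h => by
    have := congrFun (h 2) 2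
    rw [nrm_coe, vb_wEnd, map_one, Monoid.End.coe_one, id, vb_gen] at this
    simp [wVec] at this
  induction s using WithOne.recOneCoe with
  | one =>
    induction t using WithOne.recOneCoe with
    | one => rfl
    | coe y => exact (key y h).elim
  | coe x =>
    induction t using WithOne.recOneCoe with
    | one => exact (key x fun j => (h j).symm).elim
    | coe y =>
      congr 1
      funext j
      have := congrFun (h j) 0
      rw [nrm_coe, nrm_coe, vb_wEnd, vb_wEnd, vb_gen, S.dot_single, S.dot_single] at this
      simpa [wVec] using this

/-- The endomorphisms with central image, indexed by matrices. -/
def centEnd (A : Matrix (Fin 4) (Fin 4) (ZMod p)) : Monoid.End (G p) :=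
  MonoidHom.mk' (fun g => cz p (A.mulVec (vb p g))) fun g h => by
    rw [vb_mul, Matrix.mulVec_add, cz_add]

theorem centEnd_apply (A : Matrix (Fin 4) (Fin 4) (ZMod p)) (g : G p) :
    centEnd p A g = cz p (A.mulVec (vb p g)) := rfl

theorem centEnd_gen (A : Matrix (Fin 4) (Fin 4) (ZMod p)) (j : Fin 4) :
    centEnd p A (gen p j) = cz p fun i => A i j := by
  rw [centEnd_apply, vb_gen, Matrix.mulVec_single_one]
  rfl

theorem isCentral_centEnd (A : Matrix (Fin 4) (Fin 4) (ZMod p)) : IsCentral (centEnd p A) :=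
  fun _ => cz_mem_center p _

theorem centEnd_injective : Function.Injective (centEnd p) := by
  intro A B h
  ext i j
  have := DFunLike.congr_fun h (gen p j)
  rw [centEnd_gen, centEnd_gen] at this
  exact congrFun (cz_injective p this) i

theorem isMat_iff_eq_centEnd {c : Monoid.End (G p)} {A : Matrix (Fin 4) (Fin 4) (ZMod p)} :
    IsMat c A ↔ c = centEnd p A := by
  constructor
  · exact fun h => end_ext fun j => (h j).trans (by rw [centEnd_gen, cz_eq])
  · rintro rfl j
    rw [centEnd_gen, cz_eq]

theorem exists_eq_centEnd {c : Monoid.End (G p)} (hc : IsCentral c) : ∃ A, c = centEnd p A := by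
  choose z hz using fun j => exists_eq_cz_of_mem_center p (hc (gen p j))
  exact ⟨Matrix.of fun i j => z j i, end_ext fun j => by rw [hz, centEnd_gen]; rfl⟩

/-- The endomorphism with given normalized and central parts. -/
def ofPair (m : MatS1 p) : Monoid.End (G p) :=
  MonoidHom.mk' (fun g => nrm p m.right g * centEnd p m.left g) fun g h => by
    rw [map_mul, map_mul, mul_assoc, mul_assoc, ← mul_assoc (nrm p m.right h),
      centEnd_apply p m.left g, mul_cz p (nrm p m.right h), mul_assoc]

theorem ofPair_apply (m : MatS1 p) (g : G p) :
    ofPair p m g = nrm p m.right g * centEnd p m.left g := rfl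

theorem isNormCent_ofPair (m : MatS1 p) :
    IsNormCent (ofPair p m) (nrm p m.right) (centEnd p m.left) :=
  ⟨isNormalized_nrm p _, isCentral_centEnd p _, fun _ => rfl⟩

theorem vb_ofPair (m : MatS1 p) (g : G p) : vb p (ofPair p m g) = vb p (nrm p m.right g) := by
  rw [ofPair_apply, vb_mul, centEnd_apply, vb_cz, add_zero]

/-! ### Composition and the two actions -/

theorem nrm_centEnd (s : S1 p) (A : Matrix (Fin 4) (Fin 4) (ZMod p)) (g : G p) :
    nrm p s (centEnd p A g) = centEnd p (leftAct p s A) g := by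
  induction s using WithOne.recOneCoe with
  | one => simp
  | coe x =>
    change wEnd p x (centEnd p A g) = centEnd p 0 g
    rw [wEnd_apply, centEnd_apply, centEnd_apply, vb_cz, S.dot_zero]
    simp

theorem centEnd_nrm (s : S1 p) (A : Matrix (Fin 4) (Fin 4) (ZMod p)) (g : G p) :
    centEnd p A (nrm p s g) = centEnd p ((rightAct p s).unop A) g := by
  induction s using WithOne.recOneCoe with
  | one => simp
  | coe x =>
    change centEnd p A (wEnd p x g) = centEnd p (rightEnd p x A) g
    rw [centEnd_apply, centEnd_apply, vb_wEnd]
    congr 1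
    ext i
    have h : ∀ j, rightEnd p x A i j = x j * (A i 0 - A i 1) := fun _ => rfl
    simp only [Matrix.mulVec, dotProduct, Fin.sum_univ_four, S.dot, wVec, h, Pi.smul_apply,
      Matrix.cons_val, smul_eq_mul]
    ring

theorem centEnd_eq_of_vb (A : Matrix (Fin 4) (Fin 4) (ZMod p)) {g h : G p}
    (e : vb p g = vb p h) : centEnd p A g = centEnd p A h := by
  rw [centEnd_apply, centEnd_apply, e]

theorem centEnd_add (A B : Matrix (Fin 4) (Fin 4) (ZMod p)) (g : G p) :
    centEnd p (A + B) g = centEnd p A g * centEnd p B g := by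
  rw [centEnd_apply, Matrix.add_mulVec, cz_add]
  rfl

theorem ofPair_mul (m n : MatS1 p) : ofPair p (m * n) = ofPair p m * ofPair p n := by
  ext g
  change nrm p (m.right * n.right) g *
      centEnd p ((rightAct p n.right).unop m.left + leftAct p m.right n.left) g =
    nrm p m.right (ofPair p n g) * centEnd p m.left (ofPair p n g)
  rw [centEnd_eq_of_vb p m.left (vb_ofPair p n g), centEnd_nrm, ofPair_apply, map_mul, map_mul,
    nrm_centEnd, centEnd_add, mul_assoc]
  congr 1
  exact mul_cz p _ _

theorem ofPair_injective : Function.Injective (ofPair p) := by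
  intro m n h
  have hr : m.right = n.right := nrm_injective_of_vb p fun j => by
    rw [← vb_ofPair, ← vb_ofPair, h]
  refine TwoSided.ext (centEnd_injective p ?_) hr
  ext g
  have := DFunLike.congr_fun h g
  rw [ofPair_apply, ofPair_apply, hr] at this
  exact mul_left_cancel this

/-! ### Classification of all endomorphisms -/

theorem vb_gen_eq_single_or_smul_wVec (f : Monoid.End (G p)) :
    (∀ j, vb p (f (gen p j)) = Pi.single j 1) ∨
    ∀ j, ∃ x : ZMod p, vb p (f (gen p j)) = x • wVec p := by
  have e0 : f (gen p 0) ^ p = ⁅f (gen p 0), f (gen p 2)⁆ := by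
    rw [← map_pow, gen_zero_pow, ← map_commutatorElement]; rfl
  have e1 : f (gen p 1) ^ p = ⁅f (gen p 0), f (gen p 2)⁆ := by
    rw [← map_pow, gen_one_pow, ← map_commutatorElement]; rfl
  have e2 : f (gen p 2) ^ p = ⁅f (gen p 1), f (gen p 2) * f (gen p 3)⁆ := by
    rw [← map_pow, gen_two_pow_eq_commutator, ← map_mul, ← map_commutatorElement]
  have e3 : f (gen p 3) ^ p = ⁅f (gen p 1), f (gen p 3)⁆ := by
    rw [← map_pow, gen_three_pow, ← map_commutatorElement]; rfl
  have e4 : ⁅f (gen p 0), f (gen p 1)⁆ = cz p 0 := by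
    rw [cz_zero]
    exact commutatorElement_eq_one_iff_mul_comm.2 ((commute_gen_zero_one p).map f).eq
  have e5 : ⁅f (gen p 2), f (gen p 3)⁆ = cz p 0 := by
    rw [cz_zero]
    exact commutatorElement_eq_one_iff_mul_comm.2 ((commute_gen_two_three p).map f).eq
  rw [pow_prime_eq_cz, commutator_eq_cz] at e0 e1 e2 e3
  rw [commutator_eq_cz] at e4 e5
  rw [vb_mul] at e2
  rcases classify (cz_injective p e0) (cz_injective p e1) (cz_injective p e2)
    (cz_injective p e3) (cz_injective p e4) (cz_injective p e5) with ⟨h0, h1, h2, h3⟩ | h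
  · left
    intro j
    fin_cases j <;> assumption
  · right
    intro j
    obtain ⟨h1, h2, h3⟩ := h (vb p (f (gen p j))) (by fin_cases j <;> simp)
    refine ⟨vb p (f (gen p j)) 0, ?_⟩
    ext i
    fin_cases i <;> simp [wVec, h1, h2, h3]

theorem exists_eq_mul_cz {g h : G p} (e : vb p g = vb p h) : ∃ z, g = h * cz p z := by
  obtain ⟨z, hz⟩ := exists_eq_cz p (g := h⁻¹ * g) (by simp [e])
  exact ⟨z, by rw [← hz, mul_inv_cancel_left]⟩

/-- The classification provides a normalized endomorphism that agrees with `f` modulo the center on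
generators; the central discrepancies are the columns of the matrix. -/
theorem ofPair_surjective : Function.Surjective (ofPair p) := by
  intro f
  obtain ⟨s, hs⟩ : ∃ s, ∀ j, vb p (f (gen p j)) = vb p (nrm p s (gen p j)) := by
    rcases vb_gen_eq_single_or_smul_wVec p f with h | h
    · refine ⟨1, fun j => ?_⟩
      rw [h, map_one, Monoid.End.coe_one, id, vb_gen]
    · choose x hx using h
      let y : S p := x
      refine ⟨(y : S1 p), fun j => ?_⟩
      rw [hx, nrm_coe, vb_wEnd, vb_gen, S.dot_single]
  choose z hz using fun j => exists_eq_mul_cz p (hs j)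
  refine ⟨⟨Matrix.of fun i j => z j i, s⟩, end_ext fun j => ?_⟩
  rw [ofPair_apply, hz, centEnd_gen]
  rfl

theorem exists_eq_nrm {n : Monoid.End (G p)} (hn : IsNormalized n) : ∃ s, n = nrm p s := by
  obtain ⟨m, rfl⟩ := ofPair_surjective p n
  -- The central factor does not change coordinates modulo the center, and each coset has only one
  -- representative.
  exact ⟨m.right, end_ext fun j =>
    eq_of_mem_reps p (hn j) (isNormalized_nrm p _ j) (vb_ofPair p m _)⟩

theorem exists_eq_of_isNormCent {f n c : Monoid.End (G p)} (h : IsNormCent f n c) :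
    ∃ m : MatS1 p, f = ofPair p m ∧ n = nrm p m.right ∧ c = centEnd p m.left := by
  obtain ⟨s, rfl⟩ := exists_eq_nrm p h.1
  obtain ⟨A, rfl⟩ := exists_eq_centEnd p h.2.1
  exact ⟨⟨A, s⟩, MonoidHom.ext h.2.2, rfl, rfl⟩

end JK

/-- For every prime `p`: `norm`, `cent`, `vec` and `mat` are well-defined on `End(G_{(1,0)}^{(p)})`,
and `f ↦ (mat(cent(f)), vec(norm(f)))` is an isomorphism of monoids onto the two-sided semidirect
product of `Mat_{4,4}(𝔽_p)` and `S_p¹`. -/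
theorem corollary5p3 (p : ℕ) [Fact p.Prime] :
    (∀ f : Monoid.End (JK.G p), ∃! nc : Monoid.End (JK.G p) × Monoid.End (JK.G p),
      JK.IsNormCent f nc.1 nc.2) ∧
    (∀ n : Monoid.End (JK.G p), JK.IsNormalized n → ∃! v : JK.S1 p, JK.IsVec n v) ∧
    (∀ c : Monoid.End (JK.G p), JK.IsCentral c →
      ∃! A : Matrix (Fin 4) (Fin 4) (ZMod p), JK.IsMat c A) ∧
    ∃ α : Monoid.End (JK.G p) ≃* JK.MatS1 p,
      ∀ f n c : Monoid.End (JK.G p), JK.IsNormCent f n c →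
        JK.IsMat c (α f).left ∧ JK.IsVec n (α f).right := by
  refine ⟨fun f => ?_, fun n hn => ?_, fun c hc => ?_, ?_⟩
  · obtain ⟨m, rfl⟩ := JK.ofPair_surjective p f
    refine ⟨(JK.nrm p m.right, JK.centEnd p m.left), JK.isNormCent_ofPair p m, ?_⟩
    rintro ⟨n, c⟩ h
    obtain ⟨m', hm, rfl, rfl⟩ := JK.exists_eq_of_isNormCent p h
    rw [JK.ofPair_injective p hm]
  · obtain ⟨s, rfl⟩ := JK.exists_eq_nrm p hn
    refine ⟨s, (JK.isVec_iff_eq_nrm p).2 rfl, fun t ht => ?_⟩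
    have h := (JK.isVec_iff_eq_nrm p).1 ht
    exact (JK.nrm_injective_of_vb p fun j => by rw [h]).symm
  · obtain ⟨A, rfl⟩ := JK.exists_eq_centEnd p hc
    exact ⟨A, (JK.isMat_iff_eq_centEnd p).2 rfl, fun B hB =>
      (JK.centEnd_injective p ((JK.isMat_iff_eq_centEnd p).1 hB)).symm⟩
  · let e := MulEquiv.ofBijective (MulHom.mk (JK.ofPair p) (JK.ofPair_mul p))
      ⟨JK.ofPair_injective p, JK.ofPair_surjective p⟩
    refine ⟨e.symm, fun f n c h => ?_⟩
    obtain ⟨m, rfl, rfl, rfl⟩ := JK.exists_eq_of_isNormCent p h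
    have he : e.symm (JK.ofPair p m) = m := e.symm_apply_apply m
    rw [he]
    exact ⟨(JK.isMat_iff_eq_centEnd p).2 rfl, (JK.isVec_iff_eq_nrm p).2 rfl⟩
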